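/- Let $\Omega\subset\mathbb R^2$ be a bounded open set with $0\in\Omega$, let $F>0$, and let $h_0\in C^1(\overline\Omega)$ (that is, $h_0$ is $C^1$ in $\Omega$, and $h_0$ and $\nabla h_0$ extend continuously to $\overline\Omega$) satisfy $\min_{x\in\Omega}h_0(x)=h_0(0)=0$. Let $K=\{\varphi\in H^1_0(\Omega):\varphi\ge 0 \text{ a.e. in }\Omega\}$. 1. For every $\beta>0$ and $\gamma\in\mathbb R$ there is a unique $q=q_{\beta,\gamma}\in K$ such that $$\int_\Omega (h_0+\beta)^3\,\nabla q\cdot\nabla(\varphi-q)\,dx\;\ge\;\int_\Omega h_0\,\frac{\partial}{\partial x_1}(\varphi-q)\,dx-\gamma\int_\Omega(\varphi-q)\,dx\qquad\text{for all }\varphi\in K,$$ so that $G:\,]0,\infty[\,\times\mathbb R\to\mathbb R$, $G(\beta,\gamma)=\int_\Omega q_{\beta,\gamma}\,dx-F$, is well defined. 2. $G$ is locally Lipschitz on $]0,\infty[\,\times\mathbb R$. 3. Consequently, for all $\eta_0>0$ and $\eta_1\in\mathbb R$ the Cauchy problem $$\eta''=G(\eta,\eta'),\qquad \eta(0)=\eta_0,\qquad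 \eta'(0)=\eta_1,$$ has a unique solution locally in time: there are $T>0$ and a positive solution $\eta\in C^2([0,T[)$, and any two positive $C^2$ solutions, on $[0,T[$ and on $[0,T'[$ respectively, coincide on $[0,\min(T,T')[$. -/

import Mathlib

open MeasureTheory Set Filter Topology
open scoped ContDiff

noncomputable section

/-- The Euclidean plane. -/
abbrev Plane : Type := EuclideanSpace ℝ (Fin 2)

/-- `φ ∈ C_c^∞(Ω)`: smooth on the plane, with compact support contained in `Ω`. -/
def IsTestFunction (Ω : Set Plane) (φ : Plane → ℝ) : Prop :=
  ContDiff ℝ ∞ φ ∧ HasCompactSupport φ ∧ tsupport φ ⊆ Ω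

/-- The Hilbert space `L²(Ω; ℝ) × L²(Ω; ℝ²)`, with `‖(u, g)‖² = ‖u‖² + ‖g‖²`.
A Sobolev function `u` is represented by the pair `(u, ∇u)`, so that the norm of this space
restricts to the usual `H¹(Ω)` norm. -/
abbrev L2Pair (Ω : Set Plane) : Type :=
  WithLp 2 (Lp ℝ 2 (volume.restrict Ω) × Lp Plane 2 (volume.restrict Ω))

/-- The graph `{(φ, ∇φ) : φ ∈ C_c^∞(Ω)}`. -/
def testGraph (Ω : Set Plane) : Set (L2Pair Ω) :=
  {p | ∃ φ : Plane → ℝ, IsTestFunction Ω φ ∧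
    (p.fst : Plane → ℝ) =ᵐ[volume.restrict Ω] φ ∧
    (p.snd : Plane → Plane) =ᵐ[volume.restrict Ω] gradient φ}

/-- `H¹₀(Ω)`, the closure of `C_c^∞(Ω)` in the `H¹` norm; its elements are the pairs `(u, ∇u)`
with `u ∈ H¹₀(Ω)` and `∇u` the weak gradient of `u` (see `H10_weakGradient`). -/
def H10 (Ω : Set Plane) : Submodule ℝ (L2Pair Ω) :=
  (Submodule.span ℝ (testGraph Ω)).topologicalClosure

/-- `g` is the weak gradient of `u` in `Ω`. -/
def IsWeakGradient (Ω : Set Plane) (u : Plane → ℝ) (g : Plane → Plane) : Prop :=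
  ∀ φ : Plane → ℝ, IsTestFunction Ω φ → ∀ i : Fin 2,
    ∫ x in Ω, u x * (gradient φ x) i = - ∫ x in Ω, (g x) i * φ x

theorem gradient_coord (φ : Plane → ℝ) (x : Plane) (i : Fin 2) :
    (gradient φ x) i = fderiv ℝ φ x (EuclideanSpace.single i 1) := by
  have h : inner ℝ (gradient φ x) (EuclideanSpace.single i (1 : ℝ))
      = fderiv ℝ φ x (EuclideanSpace.single i 1) := by
    simp [gradient]
  rw [← h, EuclideanSpace.inner_single_right]
  simp

theorem IsTestFunction.continuous_gradient {Ω : Set Plane} {φ : Plane → ℝ}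
    (h : IsTestFunction Ω φ) : Continuous (gradient φ) :=
  (InnerProductSpace.toDual ℝ Plane).symm.continuous.comp
    (h.1.continuous_fderiv (by simp))

theorem IsTestFunction.hasCompactSupport_gradient {Ω : Set Plane} {φ : Plane → ℝ}
    (h : IsTestFunction Ω φ) : HasCompactSupport (gradient φ) :=
  (h.2.1.fderiv ℝ).comp_left (g := (InnerProductSpace.toDual ℝ Plane).symm) (map_zero _)

theorem IsTestFunction.memLp_gradient {Ω : Set Plane} {φ : Plane → ℝ}
    (h : IsTestFunction Ω φ) : MemLp (gradient φ) 2 (volume.restrict Ω) :=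
  (h.continuous_gradient.memLp_of_hasCompactSupport h.hasCompactSupport_gradient).restrict Ω

theorem IsTestFunction.memLp {Ω : Set Plane} {φ : Plane → ℝ}
    (h : IsTestFunction Ω φ) : MemLp φ 2 (volume.restrict Ω) :=
  (h.1.continuous.memLp_of_hasCompactSupport h.2.1).restrict Ω

/-- The second component of an element of `H¹₀(Ω)` is the weak gradient of the first one. -/
theorem H10_weakGradient {Ω : Set Plane} {p : L2Pair Ω} (hp : p ∈ H10 Ω) :
    IsWeakGradient Ω p.fst p.snd := by
  intro φ hφ i
  have hd : MemLp (fun x => (gradient φ x) i) 2 (volume.restrict Ω) :=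
    (EuclideanSpace.proj i : Plane →L[ℝ] ℝ).comp_memLp' hφ.memLp_gradient
  have he : MemLp (fun x => φ x • EuclideanSpace.single i (1 : ℝ)) 2 (volume.restrict Ω) :=
    ((ContinuousLinearMap.toSpanSingleton ℝ
      (EuclideanSpace.single i (1 : ℝ) : Plane))).comp_memLp' hφ.memLp
  let w : L2Pair Ω := WithLp.toLp 2 (hd.toLp _, he.toLp _)
  have key : ∀ q : L2Pair Ω, inner ℝ q w
      = (∫ x in Ω, q.fst x * (gradient φ x) i) + ∫ x in Ω, (q.snd x) i * φ x := by
    intro q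
    rw [WithLp.prod_inner_apply, L2.inner_def, L2.inner_def]
    congr 1
    · refine integral_congr_ae ?_
      filter_upwards [hd.coeFn_toLp] with x hx
      change inner ℝ (q.fst x) (hd.toLp _ x) = _
      rw [hx]; simp [mul_comm]
    · refine integral_congr_ae ?_
      filter_upwards [he.coeFn_toLp] with x hx
      change inner ℝ (q.snd x) (he.toLp _ x) = _
      rw [hx, inner_smul_right]
      simp [EuclideanSpace.inner_single_right, mul_comm]
  suffices h : inner ℝ p w = 0 by rw [key] at h; linarith
  have hle : H10 Ω ≤ LinearMap.ker (innerSL ℝ w).toLinearMap := by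
    refine Submodule.topologicalClosure_minimal _ ?_ (innerSL ℝ w).isClosed_ker
    rw [Submodule.span_le]
    rintro q ⟨ψ, hψ, h1, h2⟩
    change inner ℝ w q = 0
    rw [real_inner_comm, key]
    have e1 : ∫ x in Ω, q.fst x * (gradient φ x) i
        = ∫ x, ψ x * fderiv ℝ φ x (EuclideanSpace.single i 1) := by
      rw [integral_congr_ae (g := fun x => ψ x * fderiv ℝ φ x (EuclideanSpace.single i 1))
        (by filter_upwards [h1] with x hx; rw [hx, gradient_coord])]
      refine setIntegral_eq_integral_of_forall_compl_eq_zero fun x hx => ?_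
      rw [image_eq_zero_of_notMem_tsupport fun h => hx (hψ.2.2 h), zero_mul]
    have e2 : ∫ x in Ω, (q.snd x) i * φ x
        = ∫ x, fderiv ℝ ψ x (EuclideanSpace.single i 1) * φ x := by
      rw [integral_congr_ae (g := fun x => fderiv ℝ ψ x (EuclideanSpace.single i 1) * φ x)
        (by filter_upwards [h2] with x hx; rw [hx, gradient_coord])]
      refine setIntegral_eq_integral_of_forall_compl_eq_zero fun x hx => ?_
      rw [image_eq_zero_of_notMem_tsupport fun h => hx (hφ.2.2 h), mul_zero]
    have cφ' : Continuous fun x => fderiv ℝ φ x (EuclideanSpace.single i 1) :=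
      (hφ.1.continuous_fderiv (by simp)).clm_apply continuous_const
    have cψ' : Continuous fun x => fderiv ℝ ψ x (EuclideanSpace.single i 1) :=
      (hψ.1.continuous_fderiv (by simp)).clm_apply continuous_const
    rw [e1, e2, integral_mul_fderiv_eq_neg_fderiv_mul_of_integrable, neg_add_cancel]
    · exact (cψ'.mul hφ.1.continuous).integrable_of_hasCompactSupport hφ.2.1.mul_left
    · exact (hψ.1.continuous.mul cφ').integrable_of_hasCompactSupport hψ.2.1.mul_right
    · exact (hψ.1.continuous.mul hφ.1.continuous).integrable_of_hasCompactSupport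
        hψ.2.1.mul_right
    · exact fun x _ => hψ.1.differentiable (by simp) x
    · exact fun x _ => hφ.1.differentiable (by simp) x
  have h0 : inner ℝ w p = 0 := hle hp
  rwa [real_inner_comm] at h0

/-- The cone `K` of nonnegative functions of `H¹₀(Ω)`. -/
def coneK (Ω : Set Plane) : Set (L2Pair Ω) :=
  {p | p ∈ H10 Ω ∧ ∀ᵐ x ∂(volume.restrict Ω), 0 ≤ p.fst x}

/-- `h ∈ C¹(closure Ω)`: `h` is `C¹` in the open set `Ω`, and `h` and its gradient extend
continuously to the closure of `Ω` (the extension of `h` being `h` itself). -/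
def IsC1OnClosure (Ω : Set Plane) (h : Plane → ℝ) : Prop :=
  ContinuousOn h (closure Ω) ∧
  ∃ D : Plane → Plane, ContinuousOn D (closure Ω) ∧ ∀ x ∈ Ω, HasGradientAt h (D x) x

/-- `q ∈ K` solves the Reynolds variational inequality with parameters `β`, `γ`. The first
coordinate `x₁` has index `0`. -/
def IsReynoldsSolution (Ω : Set Plane) (h₀ : Plane → ℝ) (β γ : ℝ) (q : L2Pair Ω) : Prop :=
  q ∈ coneK Ω ∧ ∀ φ ∈ coneK Ω,
    (∫ x in Ω, h₀ x * (φ.snd x - q.snd x) 0) - γ * ∫ x in Ω, (φ.fst x - q.fst x)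
      ≤ ∫ x in Ω, (h₀ x + β) ^ 3 * inner ℝ (q.snd x) (φ.snd x - q.snd x)

/-- The solution `q` of the Reynolds variational inequality (an arbitrary element if there is
none). -/
def reynoldsSolution (Ω : Set Plane) (h₀ : Plane → ℝ) (β γ : ℝ) : L2Pair Ω :=
  Classical.epsilon (IsReynoldsSolution Ω h₀ β γ)

/-- `G(β, γ) = ∫_Ω q - F`, with `q` the solution of the Reynolds variational inequality with
parameters `β` and `γ`. It is used for `β > 0` only. -/
def forceG (Ω : Set Plane) (h₀ : Plane → ℝ) (F : ℝ) (z : ℝ × ℝ) : ℝ :=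
  (∫ x in Ω, (reynoldsSolution Ω h₀ z.1 z.2).fst x) - F

/-- `η ∈ C²([0,T[)` is positive and solves `η'' = G(η, η')` on `[0,T[`, with `η(0) = η₀` and
`η'(0) = η₁`; derivatives at `0` are one-sided. -/
def IsCauchySolution (G : ℝ × ℝ → ℝ) (η₀ η₁ T : ℝ) (η : ℝ → ℝ) : Prop :=
  ContDiffOn ℝ 2 η (Ico 0 T) ∧
  (∀ t ∈ Ico 0 T, 0 < η t) ∧
  (∀ t ∈ Ico 0 T, HasDerivWithinAt (derivWithin η (Ico 0 T))
    (G (η t, derivWithin η (Ico 0 T) t)) (Ico 0 T) t) ∧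
  η 0 = η₀ ∧ derivWithin η (Ico 0 T) 0 = η₁

end

/-! The weight satisfies `(h₀ + β)^3 ≥ β^3 > 0` because `h₀ ≥ 0`. Together with the Poincaré
inequality (`exists_norm_fst_le_norm_snd`) this makes the bilinear form coercive on differences of
elements of the closed convex cone `coneK Ω` (`exists_coercive_weightedForm`). Existence is then the
Lions–Stampacchia theorem, `exists_isVISolution`.

One estimate, `IsVISolution.norm_sub_le`, carries the rest: testing each of two inequalities with
the solution of the other bounds `q - q'` by the change in the data. Equal data give uniqueness. For
`β` in a compact interval of positive numbers, coercivity is uniform and the weight is Lipschitz in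
`β` in the sup norm, so `q` is Lipschitz in `(β, γ)`. Since `forceG` is a continuous linear
functional of `q` minus a constant, it is locally Lipschitz.

The Cauchy problem becomes the system `z' = (z.2, G z)` on the open half plane `z.1 > 0`, where
Picard–Lindelöf and Grönwall uniqueness apply. -/

noncomputable section

/-! ### Variational inequalities in a Hilbert space -/

section VariationalInequality

variable {H : Type*} [NormedAddCommGroup H] [InnerProductSpace ℝ H]

/-- `q ∈ K` solves the variational inequality `⟪A q, φ - q⟫ ≥ ⟪w, φ - q⟫` for all `φ ∈ K`. -/
def IsVISolution (K : Set H) (A : H →L[ℝ] H) (w q : H) : Prop :=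
  q ∈ K ∧ ∀ φ ∈ K, inner ℝ w (φ - q) ≤ inner ℝ (A q) (φ - q)

/-- Adding the two obtuse-angle conditions, each tested at the other projection, gives `‖p - q‖² ≤
⟪u - v, p - q⟫`; Cauchy–Schwarz finishes. -/
theorem norm_sub_le_of_projections {K : Set H} {u v p q : H} (hp : p ∈ K) (hq : q ∈ K)
    (hup : ∀ φ ∈ K, inner ℝ (u - p) (φ - p) ≤ 0) (hvq : ∀ φ ∈ K, inner ℝ (v - q) (φ - q) ≤ 0) :
    ‖p - q‖ ≤ ‖u - v‖ := by
  have h1 := hup q hq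
  have h2 := hvq p hp
  have h3 : ‖p - q‖ ^ 2 ≤ inner ℝ (u - v) (p - q) := by
    rw [← real_inner_self_eq_norm_sq]
    simp only [inner_sub_left, inner_sub_right] at *
    linarith
  have h4 := real_inner_le_norm (u - v) (p - q)
  rcases (norm_nonneg (p - q)).eq_or_lt with h0 | h0
  · rw [← h0]; positivity
  · nlinarith

/-- Continuous dependence of the solution of a coercive variational inequality on the data. -/
theorem IsVISolution.norm_sub_le {K : Set H} {A A' : H →L[ℝ] H} {w w' q q' : H} {α : ℝ}
    (hA : ∀ u ∈ K, ∀ v ∈ K, α * ‖u - v‖ ^ 2 ≤ inner ℝ (A (u - v)) (u - v))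
    (hq : IsVISolution K A w q) (hq' : IsVISolution K A' w' q') :
    α * ‖q - q'‖ ≤ ‖A q' - A' q'‖ + ‖w - w'‖ := by
  have h1 := hq.2 q' hq'.1
  have h2 := hq'.2 q hq.1
  have h3 := hA q hq.1 q' hq'.1
  -- The operators are compared at `q'` only, so coercivity of `A` alone suffices.
  have h4 : α * ‖q - q'‖ ^ 2 ≤ inner ℝ (A' q' - A q') (q - q') + inner ℝ (w - w') (q - q') := by
    refine h3.trans ?_
    simp only [map_sub, inner_sub_left, inner_sub_right] at *
    linarith
  have h5 := real_inner_le_norm (A' q' - A q') (q - q')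
  have h6 := real_inner_le_norm (w - w') (q - q')
  rw [norm_sub_rev (A' q')] at h5
  rcases (norm_nonneg (q - q')).eq_or_lt with h0 | h0
  · rw [← h0, mul_zero]; positivity
  · refine le_of_mul_le_mul_right ?_ h0
    linarith

/-- The Lions–Stampacchia theorem. -/
theorem exists_isVISolution [CompleteSpace H] {K : Set H} (hne : K.Nonempty) (hc : IsClosed K)
    (hconv : Convex ℝ K) (A : H →L[ℝ] H) (w : H) {α : ℝ} (hα : 0 < α)
    (hA : ∀ u ∈ K, ∀ v ∈ K, α * ‖u - v‖ ^ 2 ≤ inner ℝ (A (u - v)) (u - v)) :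
    ∃ q, IsVISolution K A w q := by
  have hproj : ∀ u : H, ∃ v ∈ K, ∀ φ ∈ K, inner ℝ (u - v) (φ - v) ≤ 0 := fun u => by
    obtain ⟨v, hv, h⟩ := exists_norm_eq_iInf_of_complete_convex hne hc.isComplete hconv u
    exact ⟨v, hv, (norm_eq_iInf_iff_real_inner_le_zero hconv hv).1 h⟩
  choose P hPK hP using hproj
  -- Adding `α` to the norm makes `M` positive and at least `α`, hence `0 ≤ κ < 1` below.
  set M : ℝ := ‖A‖ + α with hM
  have hM0 : 0 < M := by positivity
  -- This step length minimizes `1 - 2ρα + ρ²M²`, a bound for the squared Lipschitz constant of `T`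
  -- on `K`; the minimum is `κ`.
  set ρ : ℝ := α / M ^ 2 with hρ
  have hρ0 : 0 < ρ := by positivity
  set κ : ℝ := 1 - α ^ 2 / M ^ 2 with hκ
  have hκ0 : 0 ≤ κ := by
    rw [hκ, sub_nonneg, div_le_one (by positivity)]
    exact pow_le_pow_left₀ hα.le (by simp [hM]) 2
  have hκ1 : κ < 1 := by
    have : 0 < α ^ 2 / M ^ 2 := by positivity
    linarith
  let T : H → H := fun u => P (u - ρ • (A u - w))
  have hTK : MapsTo T K K := fun u _ => hPK _
  have hcontr : ∀ u ∈ K, ∀ v ∈ K, ‖T u - T v‖ ≤ √κ * ‖u - v‖ := by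
    intro u hu v hv
    refine (norm_sub_le_of_projections (hPK _) (hPK _) (hP _) (hP _)).trans ?_
    have e : (u - ρ • (A u - w)) - (v - ρ • (A v - w)) = (u - v) - ρ • A (u - v) := by
      rw [map_sub]; module
    rw [e]
    refine abs_le_of_sq_le_sq' ?_ (by positivity) |>.2
    rw [mul_pow, Real.sq_sqrt hκ0, norm_sub_sq_real, inner_smul_right, norm_smul, mul_pow,
      real_inner_comm, Real.norm_eq_abs, sq_abs]
    have h1 := hA u hu v hv
    have h2 : ‖A (u - v)‖ ^ 2 ≤ M ^ 2 * ‖u - v‖ ^ 2 := by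
      rw [← mul_pow]
      refine pow_le_pow_left₀ (norm_nonneg _) ((A.le_opNorm _).trans ?_) 2
      gcongr
      simp [hM, hα.le]
    have h3 : ρ * (α * ‖u - v‖ ^ 2) = α ^ 2 / M ^ 2 * ‖u - v‖ ^ 2 := by rw [hρ]; ring
    have h4 : ρ ^ 2 * (M ^ 2 * ‖u - v‖ ^ 2) = α ^ 2 / M ^ 2 * ‖u - v‖ ^ 2 := by
      rw [hρ]; field_simp
    have h5 := mul_le_mul_of_nonneg_left h1 hρ0.le
    have h6 := mul_le_mul_of_nonneg_left h2 (sq_nonneg ρ)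
    rw [hκ, sub_mul, one_mul]
    linarith
  obtain ⟨x, hx⟩ := hne
  have hCW : ContractingWith (Real.toNNReal √κ) (hTK.restrict T K K) := by
    refine ⟨?_, LipschitzWith.of_dist_le_mul fun u v => ?_⟩
    · rw [Real.toNNReal_lt_one]
      exact (Real.sqrt_lt' one_pos).2 (by simpa using hκ1)
    · rw [Real.coe_toNNReal _ (Real.sqrt_nonneg _), Subtype.dist_eq, Subtype.dist_eq, dist_eq_norm,
        dist_eq_norm]
      exact hcontr u u.2 v v.2
  obtain ⟨q, hq, hfix, -⟩ := hCW.exists_fixedPoint' hc.isComplete hTK hx (edist_ne_top _ _)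
  refine ⟨q, hq, fun φ hφ => ?_⟩
  -- At a fixed point of `T`, the characterization of the projection is the variational inequality
  -- multiplied by `ρ`.
  have h := hP (q - ρ • (A q - w)) φ hφ
  have hfix' : P (q - ρ • (A q - w)) = q := hfix
  rw [hfix'] at h
  have e : q - ρ • (A q - w) - q = ρ • (w - A q) := by module
  rw [e, inner_smul_left, inner_sub_left] at h
  have h' := nonpos_of_mul_nonpos_right h (by simpa using hρ0)
  linarith

end VariationalInequality

/-! ### The Poincaré inequality and the cone of nonnegative functions -/

section Sobolev

variable {Ω : Set Plane}

theorem norm_gradient_eq_norm_fderiv (φ : Plane → ℝ) (x : Plane) :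
    ‖gradient φ x‖ = ‖fderiv ℝ φ x‖ :=
  (InnerProductSpace.toDual ℝ Plane).symm.norm_map _

theorem IsTestFunction.add {φ ψ : Plane → ℝ} (hφ : IsTestFunction Ω φ)
    (hψ : IsTestFunction Ω ψ) : IsTestFunction Ω (φ + ψ) :=
  ⟨hφ.1.add hψ.1, hφ.2.1.add hψ.2.1,
    (tsupport_add _ _).trans (union_subset hφ.2.2 hψ.2.2)⟩

theorem IsTestFunction.const_smul {φ : Plane → ℝ} (hφ : IsTestFunction Ω φ) (c : ℝ) :
    IsTestFunction Ω (c • φ) :=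
  ⟨contDiff_const.smul hφ.1, hφ.2.1.smul_left (f := fun _ => c),
    (tsupport_smul_subset_right (fun _ => c) φ).trans hφ.2.2⟩

/-- Test functions form a vector space and the gradient is linear, so taking the span adds nothing:
elements of `H10 Ω` are limits of genuine test functions. -/
theorem span_testGraph_subset : (Submodule.span ℝ (testGraph Ω) : Set (L2Pair Ω)) ⊆ testGraph Ω := by
  intro p hp
  induction hp using Submodule.span_induction with
  | mem p hp => exact hp
  | zero =>
    refine ⟨0, ⟨contDiff_const, HasCompactSupport.zero, by simp⟩, ?_, ?_⟩
    · simpa using Lp.coeFn_zero ℝ 2 (volume.restrict Ω)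
    · filter_upwards [Lp.coeFn_zero Plane 2 (volume.restrict Ω)] with x hx
      rw [WithLp.zero_snd, hx]
      simp [gradient]
  | add p q _ _ hp hq =>
    obtain ⟨φ, hφ, h1, h2⟩ := hp
    obtain ⟨ψ, hψ, h3, h4⟩ := hq
    refine ⟨φ + ψ, hφ.add hψ, ?_, ?_⟩
    · filter_upwards [Lp.coeFn_add p.fst q.fst, h1, h3] with x hx e1 e2
      rw [WithLp.add_fst, hx, Pi.add_apply, e1, e2, Pi.add_apply]
    · filter_upwards [Lp.coeFn_add p.snd q.snd, h2, h4] with x hx e1 e2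
      rw [WithLp.add_snd, hx, Pi.add_apply, e1, e2]
      simp only [gradient]
      rw [fderiv_add (hφ.1.differentiable (by simp) x) (hψ.1.differentiable (by simp) x), map_add]
  | smul c p _ hp =>
    obtain ⟨φ, hφ, h1, h2⟩ := hp
    refine ⟨c • φ, hφ.const_smul c, ?_, ?_⟩
    · filter_upwards [Lp.coeFn_smul c p.fst, h1] with x hx e1
      rw [WithLp.smul_fst, hx, Pi.smul_apply, e1, Pi.smul_apply]
    · filter_upwards [Lp.coeFn_smul c p.snd, h2] with x hx e1
      rw [WithLp.smul_snd, hx, Pi.smul_apply, e1]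
      simp only [gradient]
      rw [fderiv_const_smul (hφ.1.differentiable (by simp) x), map_smulₛₗ]
      simp

theorem eLpNorm_one_le_of_support_subset {V : Type*} [NormedAddCommGroup V] {f : Plane → V}
    (hf : AEStronglyMeasurable f volume) (hs : Function.support f ⊆ Ω) :
    eLpNorm f 1 volume ≤ eLpNorm f 2 (volume.restrict Ω) * volume Ω ^ (1 / 2 : ℝ) := by
  have h := eLpNorm_le_eLpNorm_mul_rpow_measure_univ (p := 1) (q := 2) one_le_two
    (hf.restrict (s := Ω))
  rw [eLpNorm_restrict_eq_of_support_subset hs, Measure.restrict_apply_univ] at h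
  convert! h using 3
  norm_num

/-- In the plane the Sobolev inequality bounds the `L²` norm by the `L¹` norm of the derivative, and
Hölder on the bounded set `Ω` bounds that by the `L²` norm. Exponent `1` is used because the Sobolev
inequality needs an exponent below the dimension `2`. -/
theorem exists_eLpNorm_le_eLpNorm_gradient (hΩ : Bornology.IsBounded Ω) :
    ∃ C : NNReal, ∀ φ, IsTestFunction Ω φ →
      eLpNorm φ 2 (volume.restrict Ω) ≤ C * eLpNorm (gradient φ) 2 (volume.restrict Ω) := by
  have hd : volume Ω ^ (1 / 2 : ℝ) ≠ ⊤ :=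
    ENNReal.rpow_ne_top_of_nonneg (by norm_num) hΩ.measure_lt_top.ne
  obtain ⟨d, hd⟩ : ∃ d : NNReal, (d : ENNReal) = volume Ω ^ (1 / 2 : ℝ) :=
    ⟨_, ENNReal.coe_toNNReal hd⟩
  refine ⟨eLpNormLESNormFDerivOfLeConst ℝ (volume : Measure Plane) Ω 1 2 * d, fun φ hφ => ?_⟩
  have h1 : eLpNorm φ 2 volume ≤ eLpNormLESNormFDerivOfLeConst ℝ (volume : Measure Plane) Ω 1 2 *
      eLpNorm (fderiv ℝ φ) 1 volume :=
    eLpNorm_le_eLpNorm_fderiv_of_le (μ := (volume : Measure Plane)) (p := 1) (q := 2)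
      (hφ.1.of_le (by simp)) ((subset_tsupport φ).trans hφ.2.2) le_rfl (by simp)
      (by rw [finrank_euclideanSpace_fin]; norm_num) hΩ
  have h2 := eLpNorm_one_le_of_support_subset (Ω := Ω)
    (hφ.1.continuous_fderiv (by simp)).aestronglyMeasurable
    ((support_fderiv_subset ℝ).trans hφ.2.2)
  have h3 : eLpNorm (fderiv ℝ φ) 2 (volume.restrict Ω) = eLpNorm (gradient φ) 2 (volume.restrict Ω) :=
    eLpNorm_congr_norm_ae (.of_forall fun x => (norm_gradient_eq_norm_fderiv φ x).symm)
  rw [h3, ← hd] at h2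
  refine (eLpNorm_restrict_le φ 2 volume Ω).trans (h1.trans ?_)
  rw [ENNReal.coe_mul, mul_assoc, mul_comm (d : ENNReal)]
  gcongr

/-- The Poincaré inequality in `H¹₀(Ω)`. -/
theorem exists_norm_fst_le_norm_snd (hΩ : Bornology.IsBounded Ω) :
    ∃ C : ℝ, 0 ≤ C ∧ ∀ p ∈ H10 Ω, ‖p.fst‖ ≤ C * ‖p.snd‖ := by
  obtain ⟨C, hC⟩ := exists_eLpNorm_le_eLpNorm_gradient hΩ
  refine ⟨C, C.2, fun p hp => ?_⟩
  have hclosed : IsClosed {p : L2Pair Ω | ‖p.fst‖ ≤ C * ‖p.snd‖} :=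
    isClosed_le (WithLp.fstL 2 ℝ _ _).continuous.norm
      (continuous_const.mul (WithLp.sndL 2 ℝ _ _).continuous.norm)
  refine closure_minimal (fun q hq => ?_) hclosed hp
  obtain ⟨φ, hφ, h1, h2⟩ := span_testGraph_subset hq
  have h := hC φ hφ
  rw [← eLpNorm_congr_ae h1, ← eLpNorm_congr_ae h2] at h
  change ‖q.fst‖ ≤ C * ‖q.snd‖
  rw [Lp.norm_def, Lp.norm_def, ← ENNReal.coe_toReal, ← ENNReal.toReal_mul]
  exact ENNReal.toReal_mono (ENNReal.mul_ne_top (by simp) (Lp.eLpNorm_ne_top _)) h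

/-- Written with the order of `L²`, the sign condition is the preimage of a closed set under a
continuous map. -/
theorem coneK_eq : coneK Ω = (H10 Ω : Set (L2Pair Ω)) ∩
    (WithLp.fstL 2 ℝ (Lp ℝ 2 (volume.restrict Ω)) (Lp Plane 2 (volume.restrict Ω))) ⁻¹' Ici 0 := by
  ext p
  exact and_congr_right fun _ => Lp.coeFn_nonneg _

theorem isClosed_coneK : IsClosed (coneK Ω) := by
  rw [coneK_eq]
  exact (Submodule.isClosed_topologicalClosure _).inter
    (isClosed_Ici.preimage (ContinuousLinearMap.continuous _))

theorem convex_coneK : Convex ℝ (coneK Ω) := by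
  rintro p ⟨hp, hp'⟩ q ⟨hq, hq'⟩ a b ha hb hab
  refine ⟨(H10 Ω).convex hp hq ha hb hab, ?_⟩
  rw [WithLp.add_fst, WithLp.smul_fst, WithLp.smul_fst]
  filter_upwards [hp', hq', Lp.coeFn_add (a • p.fst) (b • q.fst), Lp.coeFn_smul a p.fst,
    Lp.coeFn_smul b q.fst] with x h1 h2 h3 h4 h5
  rw [h3, Pi.add_apply, h4, h5]
  exact add_nonneg (mul_nonneg ha h1) (mul_nonneg hb h2)

theorem zero_mem_coneK : (0 : L2Pair Ω) ∈ coneK Ω := by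
  rw [coneK_eq]
  exact ⟨zero_mem _, by simp⟩

end Sobolev

/-! ### Weighted gradient forms as bounded operators -/

section Operator

variable {Ω : Set Plane}

/-- The bounded operator on `L²(Ω; ℝ) × L²(Ω; ℝ²)` that represents the form
`(p, q) ↦ ∫_Ω m p₂ · q₂`. -/
def weightedForm (m : Lp ℝ ⊤ (volume.restrict Ω)) : L2Pair Ω →L[ℝ] L2Pair Ω :=
  (ContinuousLinearMap.adjoint (WithLp.sndL 2 ℝ (Lp ℝ 2 (volume.restrict Ω))
    (Lp Plane 2 (volume.restrict Ω)))) ∘L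
  ((ContinuousLinearMap.lsmul ℝ ℝ).holderL (volume.restrict Ω) ⊤ 2 2 m) ∘L
  (WithLp.sndL 2 ℝ (Lp ℝ 2 (volume.restrict Ω)) (Lp Plane 2 (volume.restrict Ω)))

theorem inner_weightedForm (m : Lp ℝ ⊤ (volume.restrict Ω)) (p q : L2Pair Ω) :
    inner ℝ (weightedForm m p) q = ∫ x in Ω, m x * inner ℝ (p.snd x) (q.snd x) := by
  rw [weightedForm, ContinuousLinearMap.comp_apply, ContinuousLinearMap.adjoint_inner_left,
    L2.inner_def]
  refine integral_congr_ae ?_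
  filter_upwards [(ContinuousLinearMap.lsmul ℝ ℝ : ℝ →L[ℝ] Plane →L[ℝ] Plane).coeFn_holder
    (r := 2) m p.snd] with x hx
  have hx' : ((ContinuousLinearMap.lsmul ℝ ℝ : ℝ →L[ℝ] Plane →L[ℝ] Plane).holderL
    (volume.restrict Ω) ⊤ 2 2 m p.snd) x = m x • p.snd x := hx
  change inner ℝ (((ContinuousLinearMap.lsmul ℝ ℝ : ℝ →L[ℝ] Plane →L[ℝ] Plane).holderL
    (volume.restrict Ω) ⊤ 2 2 m p.snd) x) (q.snd x) = _
  rw [hx', real_inner_smul_left]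

theorem weightedForm_sub (m m' : Lp ℝ ⊤ (volume.restrict Ω)) :
    weightedForm (m - m') = weightedForm m - weightedForm m' := by
  simp [weightedForm]

/-- The operator is linear in `m` and bounded by Hölder's inequality with exponents `⊤, 2, 2`; the
constant does not depend on `m`, so a change of weight controls the change of operator. -/
theorem exists_norm_weightedForm_le (Ω : Set Plane) :
    ∃ C : ℝ, 0 ≤ C ∧ ∀ m : Lp ℝ ⊤ (volume.restrict Ω), ‖weightedForm m‖ ≤ C * ‖m‖ := by
  set S := WithLp.sndL 2 ℝ (Lp ℝ 2 (volume.restrict Ω)) (Lp Plane 2 (volume.restrict Ω))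
  set h := (ContinuousLinearMap.lsmul ℝ ℝ : ℝ →L[ℝ] Plane →L[ℝ] Plane).holderL
    (volume.restrict Ω) ⊤ 2 2
  refine ⟨‖ContinuousLinearMap.adjoint S‖ * (‖h‖ * ‖S‖), by positivity, fun m => ?_⟩
  refine (ContinuousLinearMap.opNorm_comp_le _ _).trans ?_
  rw [mul_assoc]
  gcongr
  refine (ContinuousLinearMap.opNorm_comp_le _ _).trans ?_
  rw [mul_right_comm]
  gcongr
  exact h.le_opNorm m

end Operator

/-! ### The Reynolds inequality and its dependence on the parameters -/

section Reynolds

variable {Ω : Set Plane}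

/-- The element of `L²(Ω; ℝ) × L²(Ω; ℝ²)` that represents `p ↦ ∫_Ω p₁`. -/
def massVector (Ω : Set Plane) [IsFiniteMeasure (volume.restrict Ω)] : L2Pair Ω :=
  WithLp.toLp 2 (Lp.const 2 (volume.restrict Ω) (1 : ℝ), 0)

theorem inner_massVector [IsFiniteMeasure (volume.restrict Ω)] (p : L2Pair Ω) :
    inner ℝ (massVector Ω) p = ∫ x in Ω, p.fst x := by
  rw [massVector, WithLp.prod_inner_apply, L2.inner_def]
  simp only [inner_zero_left, add_zero]
  refine integral_congr_ae ?_
  filter_upwards [Lp.coeFn_const 2 (volume.restrict Ω) (1 : ℝ)] with x hx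
  change inner ℝ (Lp.const 2 (volume.restrict Ω) (1 : ℝ) x) (p.fst x) = _
  rw [hx]
  simp

/-- The element of `L²(Ω; ℝ) × L²(Ω; ℝ²)` that represents `p ↦ ∫_Ω h e₁ · p₂`. -/
def wedgeVector {h : Plane → ℝ}
    (hh : MemLp (fun x => h x • (EuclideanSpace.single 0 1 : Plane)) 2 (volume.restrict Ω)) :
    L2Pair Ω :=
  WithLp.toLp 2 (0, hh.toLp _)

theorem inner_wedgeVector {h : Plane → ℝ}
    (hh : MemLp (fun x => h x • (EuclideanSpace.single 0 1 : Plane)) 2 (volume.restrict Ω))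
    (p : L2Pair Ω) :
    inner ℝ (wedgeVector hh) p = ∫ x in Ω, h x * (p.snd x) 0 := by
  rw [wedgeVector, WithLp.prod_inner_apply]
  simp only [inner_zero_left, zero_add]
  rw [L2.inner_def]
  refine integral_congr_ae ?_
  filter_upwards [hh.coeFn_toLp] with x hx
  change inner ℝ (hh.toLp _ x) (p.snd x) = _
  rw [hx, real_inner_smul_left]
  simp [EuclideanSpace.inner_single_left]

/-- Each of the three integrals is an inner product with `φ - q`, which brings the problem into the
abstract setting. -/
theorem isReynoldsSolution_iff [IsFiniteMeasure (volume.restrict Ω)] {h : Plane → ℝ} {β γ : ℝ}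
    (hh : MemLp (fun x => h x • (EuclideanSpace.single 0 1 : Plane)) 2 (volume.restrict Ω))
    (hw : MemLp (fun x => (h x + β) ^ 3) ⊤ (volume.restrict Ω)) {q : L2Pair Ω} :
    IsReynoldsSolution Ω h β γ q ↔
      IsVISolution (coneK Ω) (weightedForm (hw.toLp _)) (wedgeVector hh - γ • massVector Ω) q := by
  refine and_congr_right fun _ => forall₂_congr fun φ _ => ?_
  have e1 : ∫ x in Ω, h x * (φ.snd x - q.snd x) 0 = inner ℝ (wedgeVector hh) (φ - q) := by
    rw [inner_wedgeVector]
    refine integral_congr_ae ?_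
    filter_upwards [Lp.coeFn_sub φ.snd q.snd] with x hx
    rw [WithLp.sub_snd, hx, Pi.sub_apply]
  have e2 : ∫ x in Ω, (φ.fst x - q.fst x) = inner ℝ (massVector Ω) (φ - q) := by
    rw [inner_massVector]
    refine integral_congr_ae ?_
    filter_upwards [Lp.coeFn_sub φ.fst q.fst] with x hx
    rw [WithLp.sub_fst, hx, Pi.sub_apply]
  have e3 : ∫ x in Ω, (h x + β) ^ 3 * inner ℝ (q.snd x) (φ.snd x - q.snd x)
      = inner ℝ (weightedForm (hw.toLp _) q) (φ - q) := by
    rw [inner_weightedForm]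
    refine integral_congr_ae ?_
    filter_upwards [Lp.coeFn_sub φ.snd q.snd, hw.coeFn_toLp] with x hx hx'
    rw [WithLp.sub_snd, hx, hx', Pi.sub_apply]
  rw [e1, e2, e3, inner_sub_left, real_inner_smul_left]

/-- The form `∫_Ω m ∇p · ∇p` is coercive on `H¹₀(Ω)` if `m` is bounded below. -/
theorem exists_coercive_weightedForm (hΩ : Bornology.IsBounded Ω) {c : ℝ} (hc : 0 < c) :
    ∃ α : ℝ, 0 < α ∧ ∀ m : Lp ℝ ⊤ (volume.restrict Ω), (∀ᵐ x ∂(volume.restrict Ω), c ≤ m x) →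
      ∀ u ∈ coneK Ω, ∀ v ∈ coneK Ω, α * ‖u - v‖ ^ 2 ≤ inner ℝ (weightedForm m (u - v)) (u - v) := by
  obtain ⟨C, hC0, hC⟩ := exists_norm_fst_le_norm_snd hΩ
  refine ⟨c / (C ^ 2 + 1), by positivity, fun m hm u hu v hv => ?_⟩
  set p := u - v
  have hp : p ∈ H10 Ω := sub_mem hu.1 hv.1
  have h1 : ‖p‖ ^ 2 ≤ (C ^ 2 + 1) * ‖p.snd‖ ^ 2 := by
    rw [WithLp.prod_norm_sq_eq_of_L2, add_mul, one_mul, ← mul_pow]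
    gcongr
    exact hC p hp
  have h2 : c * ‖p.snd‖ ^ 2 ≤ inner ℝ (weightedForm m p) p := by
    rw [inner_weightedForm, ← real_inner_self_eq_norm_sq, L2.inner_def, ← integral_const_mul]
    have hi := L2.integrable_inner (𝕜 := ℝ) p.snd p.snd
    refine integral_mono_ae (hi.const_mul c) ?_ ?_
    · exact (Lp.memLp m).integrable_mul (memLp_one_iff_integrable.2 hi)
    · filter_upwards [hm] with x hx
      exact mul_le_mul_of_nonneg_right hx real_inner_self_nonneg
  refine le_trans ?_ h2
  rw [div_mul_eq_mul_div, div_le_iff₀ (by positivity), mul_assoc]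
  rw [mul_comm (‖p.snd‖ ^ 2)]
  gcongr

theorem abs_pow_three_sub_pow_three_le {s t R : ℝ} (hs : |s| ≤ R) (ht : |t| ≤ R) :
    |s ^ 3 - t ^ 3| ≤ 3 * R ^ 2 * |s - t| := by
  have e : s ^ 3 - t ^ 3 = (s * s + s * t + t * t) * (s - t) := by ring
  rw [e, abs_mul]
  have hR : 0 ≤ R := (abs_nonneg s).trans hs
  gcongr
  calc |s * s + s * t + t * t| ≤ |s * s| + |s * t| + |t * t| := abs_add_three _ _ _
    _ = |s| * |s| + |s| * |t| + |t| * |t| := by simp only [abs_mul]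
    _ ≤ R * R + R * R + R * R := by gcongr
    _ = 3 * R ^ 2 := by ring

theorem memLp_smul_single [IsFiniteMeasure (volume.restrict Ω)] {h : Plane → ℝ} {M : ℝ}
    (hm : AEStronglyMeasurable h (volume.restrict Ω))
    (hM : ∀ᵐ x ∂(volume.restrict Ω), |h x| ≤ M) :
    MemLp (fun x => h x • (EuclideanSpace.single 0 1 : Plane)) 2 (volume.restrict Ω) := by
  refine MemLp.of_bound (hm.smul_const _) M ?_
  filter_upwards [hM] with x hx
  simpa [norm_smul] using hx

theorem memLp_add_const_pow_three {h : Plane → ℝ} {M : ℝ}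
    (hm : AEStronglyMeasurable h (volume.restrict Ω))
    (hM : ∀ᵐ x ∂(volume.restrict Ω), |h x| ≤ M) (β : ℝ) :
    MemLp (fun x => (h x + β) ^ 3) ⊤ (volume.restrict Ω) := by
  refine memLp_top_of_bound ((hm.add_const β).pow 3) ((M + |β|) ^ 3) ?_
  filter_upwards [hM] with x hx
  rw [Real.norm_eq_abs, abs_pow]
  gcongr
  exact (abs_add_le _ _).trans (by gcongr)

theorem ae_pow_three_le_toLp {h : Plane → ℝ} {b β : ℝ} (hb : 0 ≤ b) (hβ : b ≤ β)
    (h0 : ∀ᵐ x ∂(volume.restrict Ω), 0 ≤ h x)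
    (hw : MemLp (fun x => (h x + β) ^ 3) ⊤ (volume.restrict Ω)) :
    ∀ᵐ x ∂(volume.restrict Ω), b ^ 3 ≤ hw.toLp _ x := by
  filter_upwards [h0, hw.coeFn_toLp] with x hx hx'
  rw [hx']
  gcongr
  linarith

theorem norm_toLp_sub_toLp_le [IsFiniteMeasure (volume.restrict Ω)] {h : Plane → ℝ}
    {M B β β' : ℝ} (hM : ∀ᵐ x ∂(volume.restrict Ω), |h x| ≤ M)
    (hβ : |β| ≤ B) (hβ' : |β'| ≤ B)
    (hw : MemLp (fun x => (h x + β) ^ 3) ⊤ (volume.restrict Ω))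
    (hw' : MemLp (fun x => (h x + β') ^ 3) ⊤ (volume.restrict Ω)) :
    ‖hw.toLp _ - hw'.toLp _‖ ≤ 3 * (M + B) ^ 2 * |β - β'| := by
  have h := Lp.norm_le_of_ae_bound (f := hw.toLp _ - hw'.toLp _)
    (C := 3 * (M + B) ^ 2 * |β - β'|) (by positivity) (by
      filter_upwards [hM, hw.coeFn_toLp, hw'.coeFn_toLp, Lp.coeFn_sub (hw.toLp _) (hw'.toLp _)]
        with x hx e1 e2 e3
      rw [e3, Pi.sub_apply, e1, e2, Real.norm_eq_abs]
      refine (abs_pow_three_sub_pow_three_le (R := M + B) ?_ ?_).trans_eq (by ring_nf)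
      · exact (abs_add_le _ _).trans (by gcongr)
      · exact (abs_add_le _ _).trans (by gcongr))
  simpa using h

theorem existsUnique_isReynoldsSolution (hΩ : Bornology.IsBounded Ω) {h : Plane → ℝ} {M : ℝ}
    (hm : AEStronglyMeasurable h (volume.restrict Ω))
    (hM : ∀ᵐ x ∂(volume.restrict Ω), |h x| ≤ M) (h0 : ∀ᵐ x ∂(volume.restrict Ω), 0 ≤ h x)
    {β : ℝ} (hβ : 0 < β) (γ : ℝ) : ∃! q : L2Pair Ω, IsReynoldsSolution Ω h β γ q := by
  have : IsFiniteMeasure (volume.restrict Ω) := ⟨by simpa using hΩ.measure_lt_top⟩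
  have hh := memLp_smul_single hm hM
  have hw := memLp_add_const_pow_three hm hM β
  obtain ⟨α, hα, hcoer⟩ := exists_coercive_weightedForm hΩ (pow_pos hβ 3)
  have hA := hcoer _ (ae_pow_three_le_toLp hβ.le le_rfl h0 hw)
  obtain ⟨q, hq⟩ := exists_isVISolution ⟨0, zero_mem_coneK⟩ isClosed_coneK convex_coneK
    (weightedForm (hw.toLp _)) (wedgeVector hh - γ • massVector Ω) hα hA
  refine ⟨q, (isReynoldsSolution_iff hh hw).2 hq, fun q' hq' => ?_⟩
  have h := IsVISolution.norm_sub_le hA ((isReynoldsSolution_iff hh hw).1 hq') hq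
  rw [sub_self, sub_self, norm_zero, add_zero] at h
  exact sub_eq_zero.1 (norm_le_zero_iff.1 (nonpos_of_mul_nonpos_right h hα))

/-- The solution of the Reynolds variational inequality is Lipschitz in the parameters, on sets
where `β` is bounded and bounded away from zero, and `γ` is bounded. -/
theorem exists_norm_sub_le_of_isReynoldsSolution (hΩ : Bornology.IsBounded Ω) {h : Plane → ℝ}
    {M : ℝ} (hm : AEStronglyMeasurable h (volume.restrict Ω))
    (hM : ∀ᵐ x ∂(volume.restrict Ω), |h x| ≤ M) (h0 : ∀ᵐ x ∂(volume.restrict Ω), 0 ≤ h x)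
    {b : ℝ} (hb : 0 < b) (B : ℝ) {N : ℝ} (hN : 0 ≤ N) :
    ∃ L : ℝ, 0 ≤ L ∧ ∀ β ∈ Icc b B, ∀ β' ∈ Icc b B, ∀ γ γ' : ℝ, |γ'| ≤ N → ∀ q q' : L2Pair Ω,
      IsReynoldsSolution Ω h β γ q → IsReynoldsSolution Ω h β' γ' q' →
      ‖q - q'‖ ≤ L * (|β - β'| + |γ - γ'|) := by
  have : IsFiniteMeasure (volume.restrict Ω) := ⟨by simpa using hΩ.measure_lt_top⟩
  have hh := memLp_smul_single hm hM
  -- Taking the lower bound `b ^ 3` gives one constant `α` for all `β ≥ b`.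
  obtain ⟨α, hα, hcoer⟩ := exists_coercive_weightedForm hΩ (pow_pos hb 3)
  obtain ⟨C, hC0, hC⟩ := exists_norm_weightedForm_le Ω
  -- `R` bounds `‖q'‖`, by comparison with the solution `0` for zero right-hand side (`hzero`).
  set R : ℝ := (‖wedgeVector hh‖ + N * ‖massVector Ω‖) / α with hR
  have hR0 : 0 ≤ R := by positivity
  set D : ℝ := C * (3 * (M + B) ^ 2) * R with hD
  have hD0 : 0 ≤ D := by positivity
  refine ⟨(D + ‖massVector Ω‖) / α, by positivity,
    fun β hβ β' hβ' γ γ' hγ' q q' hq hq' => ?_⟩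
  have hw := memLp_add_const_pow_three hm hM β
  have hw' := memLp_add_const_pow_three hm hM β'
  rw [isReynoldsSolution_iff hh hw] at hq
  rw [isReynoldsSolution_iff hh hw'] at hq'
  have hA := hcoer _ (ae_pow_three_le_toLp hb.le hβ.1 h0 hw)
  have hA' := hcoer _ (ae_pow_three_le_toLp hb.le hβ'.1 h0 hw')
  have hzero : IsVISolution (coneK Ω) (weightedForm (hw'.toLp _)) 0 0 :=
    ⟨zero_mem_coneK, by simp⟩
  have hq'R : ‖q'‖ ≤ R := by
    have h := IsVISolution.norm_sub_le hA' hq' hzero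
    rw [sub_self, norm_zero, zero_add, sub_zero, sub_zero] at h
    rw [hR, le_div_iff₀ hα, mul_comm]
    refine h.trans ((norm_sub_le _ _).trans ?_)
    rw [norm_smul, Real.norm_eq_abs]
    gcongr
  have h1 : ‖weightedForm (hw.toLp _) q' - weightedForm (hw'.toLp _) q'‖ ≤ D * |β - β'| := by
    rw [← sub_apply, ← weightedForm_sub]
    refine (ContinuousLinearMap.le_opNorm _ _).trans ?_
    have hn := norm_toLp_sub_toLp_le hM (abs_le.2 ⟨by linarith [hβ.1, hβ.2], hβ.2⟩)
      (abs_le.2 ⟨by linarith [hβ'.1, hβ'.2], hβ'.2⟩) hw hw'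
    calc _ ≤ (C * (3 * (M + B) ^ 2 * |β - β'|)) * R := by
          gcongr
          exact (hC _).trans (by gcongr)
      _ = _ := by rw [hD]; ring
  have h2 : ‖(wedgeVector hh - γ • massVector Ω) - (wedgeVector hh - γ' • massVector Ω)‖
      ≤ ‖massVector Ω‖ * |γ - γ'| := by
    rw [sub_sub_sub_cancel_left, ← sub_smul, norm_smul, Real.norm_eq_abs, abs_sub_comm, mul_comm]
  have h3 := IsVISolution.norm_sub_le hA hq hq'
  rw [div_mul_eq_mul_div, le_div_iff₀ hα, mul_comm]
  have h4 : 0 ≤ D * |γ - γ'| := by positivity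
  have h5 : 0 ≤ ‖massVector Ω‖ * |β - β'| := by positivity
  linarith

theorem locallyLipschitzOn_forceG (hΩ : Bornology.IsBounded Ω) {h : Plane → ℝ}
    {M : ℝ} (hm : AEStronglyMeasurable h (volume.restrict Ω))
    (hM : ∀ᵐ x ∂(volume.restrict Ω), |h x| ≤ M) (h0 : ∀ᵐ x ∂(volume.restrict Ω), 0 ≤ h x)
    (F : ℝ) : LocallyLipschitzOn (Ioi (0 : ℝ) ×ˢ (univ : Set ℝ)) (forceG Ω h F) := by
  have : IsFiniteMeasure (volume.restrict Ω) := ⟨by simpa using hΩ.measure_lt_top⟩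
  rintro ⟨β₀, γ₀⟩ ⟨hβ₀, -⟩
  simp only [mem_Ioi] at hβ₀
  obtain ⟨L, hL0, hL⟩ := exists_norm_sub_le_of_isReynoldsSolution hΩ hm hM h0
    (half_pos hβ₀) (2 * β₀) (N := |γ₀| + 1) (by positivity)
  -- The factor `2` passes from the sum of the coordinate distances to the sup distance on `ℝ × ℝ`.
  refine ⟨Real.toNNReal (‖massVector Ω‖ * (L * 2)),
    Icc (β₀ / 2) (2 * β₀) ×ˢ Icc (γ₀ - 1) (γ₀ + 1), mem_nhdsWithin_of_mem_nhds
      (prod_mem_nhds (Icc_mem_nhds (by linarith) (by linarith))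
        (Icc_mem_nhds (by linarith) (by linarith))), LipschitzOnWith.of_dist_le_mul ?_⟩
  rintro ⟨β, γ⟩ ⟨hβ, -⟩ ⟨β', γ'⟩ ⟨hβ', hγ'⟩
  simp only at hβ hβ' hγ'
  have hsol : ∀ β ∈ Icc (β₀ / 2) (2 * β₀), ∀ γ,
      IsReynoldsSolution Ω h β γ (reynoldsSolution Ω h β γ) := fun β hβ γ =>
    Classical.epsilon_spec (existsUnique_isReynoldsSolution hΩ hm hM h0
      (by linarith [hβ.1] : 0 < β) γ).exists
  have hγN : |γ'| ≤ |γ₀| + 1 := by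
    have h1 : |γ' - γ₀| ≤ 1 := abs_le.2 ⟨by linarith [hγ'.1], by linarith [hγ'.2]⟩
    linarith [abs_sub_abs_le_abs_sub γ' γ₀]
  have h1 := hL β hβ β' hβ' γ γ' hγN _ _ (hsol β hβ γ) (hsol β' hβ' γ')
  rw [Real.coe_toNNReal _ (by positivity), Real.dist_eq, forceG, forceG, sub_sub_sub_cancel_right,
    ← inner_massVector, ← inner_massVector, ← inner_sub_right]
  refine (abs_real_inner_le_norm _ _).trans ?_
  rw [mul_assoc]
  gcongr
  refine h1.trans ?_
  rw [mul_assoc]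
  gcongr
  have h2 : |β - β'| ≤ dist (β, γ) (β', γ') := le_max_left (dist β β') (dist γ γ')
  have h3 : |γ - γ'| ≤ dist (β, γ) (β', γ') := le_max_right (dist β β') (dist γ γ')
  linarith

end Reynolds

/-! ### Local existence and uniqueness for the Cauchy problem -/

section CauchyProblem

theorem exists_forall_Icc_hasDerivWithinAt_of_lipschitzOnWith {E : Type*} [NormedAddCommGroup E]
    [NormedSpace ℝ E] [CompleteSpace E] {f : E → E} {x₀ : E} {K : NNReal} {s : Set E}
    (hs : s ∈ 𝓝 x₀) (hf : LipschitzOnWith K f s) :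
    ∃ T : ℝ, 0 < T ∧ ∃ α : ℝ → E, α 0 = x₀ ∧
      ∀ t ∈ Icc 0 T, HasDerivWithinAt α (f (α t)) (Icc 0 T) t := by
  obtain ⟨a, ha, has⟩ := Metric.nhds_basis_closedBall.mem_iff.1 hs
  have hl := hf.mono has
  lift a to NNReal using ha.le
  -- `L` bounds `f` on the ball of radius `a`; the `1` keeps it positive, so the existence time `a /
  -- L` makes sense.
  set L : NNReal := ‖f x₀‖₊ + K * a + 1 with hL
  have hL0 : (0 : ℝ) < L := by rw [hL]; positivity
  have hb : ∀ x ∈ Metric.closedBall x₀ (a : ℝ), ‖f x‖ ≤ L := by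
    intro x hx
    have h1 := hl.dist_le_mul x hx x₀ (Metric.mem_closedBall_self a.2)
    have h2 : ‖f x‖ ≤ ‖f x₀‖ + dist (f x) (f x₀) := by
      rw [dist_eq_norm]
      exact norm_le_norm_add_norm_sub' _ _
    have h3 : (K : ℝ) * dist x x₀ ≤ K * a := by
      gcongr
      exact hx
    have h4 : (L : ℝ) = ‖f x₀‖ + K * a + 1 := by simp [hL]
    linarith
  have hT : 0 < (a : ℝ) / L := div_pos ha hL0
  have hPL : IsPicardLindelof (fun _ => f) (⟨0, left_mem_Icc.2 hT.le⟩ : Icc 0 ((a : ℝ) / L))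
      x₀ a 0 L K := by
    refine .of_time_independent hb hl ?_
    simp only [sub_zero, max_eq_left hT.le, NNReal.coe_zero]
    exact (mul_div_cancel₀ _ hL0.ne').le
  obtain ⟨α, h0, hα⟩ := hPL.exists_eq_forall_mem_Icc_hasDerivWithinAt₀
  exact ⟨a / L, hT, α, h0, hα⟩

variable {G : ℝ × ℝ → ℝ}

theorem locallyLipschitzOn_firstOrderField {s : Set (ℝ × ℝ)} (hG : LocallyLipschitzOn s G) :
    LocallyLipschitzOn s (fun z : ℝ × ℝ => (z.2, G z)) := by
  intro z hz
  obtain ⟨K, t, ht, hK⟩ := hG hz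
  exact ⟨max 1 K, t, ht, LipschitzWith.prod_snd.lipschitzOnWith.prodMk hK⟩

theorem derivWithin_Ico_eq {T t : ℝ} {η : ℝ → ℝ} {d : ℝ} (ht : t ∈ Ico 0 T)
    (h : HasDerivWithinAt η d (Ico 0 T) t) : derivWithin η (Ico 0 T) t = d :=
  h.derivWithin (uniqueDiffOn_Ico 0 T t ht)

theorem exists_isCauchySolution (hG : LocallyLipschitzOn (Ioi (0 : ℝ) ×ˢ (univ : Set ℝ)) G)
    {η₀ : ℝ} (hη₀ : 0 < η₀) (η₁ : ℝ) : ∃ T : ℝ, 0 < T ∧ ∃ η, IsCauchySolution G η₀ η₁ T η := by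
  have hopen : IsOpen (Ioi (0 : ℝ) ×ˢ (univ : Set ℝ)) := isOpen_Ioi.prod isOpen_univ
  have hmem : (η₀, η₁) ∈ Ioi (0 : ℝ) ×ˢ (univ : Set ℝ) := ⟨hη₀, mem_univ _⟩
  obtain ⟨K, s, hs, hK⟩ := locallyLipschitzOn_firstOrderField hG hmem
  rw [hopen.nhdsWithin_eq hmem] at hs
  obtain ⟨T, hT, α, hα0, hα⟩ := exists_forall_Icc_hasDerivWithinAt_of_lipschitzOnWith hs hK
  have hev : ∀ᶠ t in 𝓝[Icc 0 T] 0, 0 < (α t).1 := by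
    have hc := (hα 0 (left_mem_Icc.2 hT.le)).continuousWithinAt.fst
    refine hc.eventually_mem (s := Ioi 0) (Ioi_mem_nhds ?_)
    simpa [hα0] using hη₀
  obtain ⟨δ, hδ, hball⟩ := Metric.mem_nhdsWithin_iff.1 hev
  -- Up to time `δ` continuity keeps the first component positive, so the trajectory stays where `G`
  -- is controlled.
  set S := min T δ with hS
  have hS0 : 0 < S := lt_min hT hδ
  have hsub : Ico 0 S ⊆ Icc 0 T := fun t ht => ⟨ht.1, (ht.2.trans_le (min_le_left _ _)).le⟩
  have hpos : ∀ t ∈ Ico 0 S, 0 < (α t).1 := by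
    intro t ht
    refine hball ⟨?_, hsub ht⟩
    rw [Metric.mem_ball, Real.dist_eq, sub_zero, abs_of_nonneg ht.1]
    exact ht.2.trans_le (min_le_right _ _)
  have hder : ∀ t ∈ Ico 0 S, HasDerivWithinAt α ((α t).2, G (α t)) (Ico 0 S) t :=
    fun t ht => (hα t (hsub ht)).mono hsub
  have hder1 : ∀ t ∈ Ico 0 S, HasDerivWithinAt (fun t => (α t).1) (α t).2 (Ico 0 S) t :=
    fun t ht => (hder t ht).fst
  have hder2 : ∀ t ∈ Ico 0 S, HasDerivWithinAt (fun t => (α t).2) (G (α t)) (Ico 0 S) t :=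
    fun t ht => (hder t ht).snd
  have he : EqOn (derivWithin (fun t => (α t).1) (Ico 0 S)) (fun t => (α t).2) (Ico 0 S) :=
    fun t ht => derivWithin_Ico_eq ht (hder1 t ht)
  have hGc : ContinuousOn (fun t => G (α t)) (Ico 0 S) :=
    hG.continuousOn.comp (fun t ht => (hder t ht).continuousWithinAt)
      fun t ht => ⟨hpos t ht, mem_univ _⟩
  have hu := uniqueDiffOn_Ico (0 : ℝ) S
  -- The derivative of the second component is the continuous function `G ∘ α`; since that component
  -- is itself the derivative of the first, the first is `C²`.
  have hC1 : ContDiffOn ℝ 1 (fun t => (α t).2) (Ico 0 S) := by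
    rw [contDiffOn_one_iff_derivWithin hu]
    exact ⟨fun t ht => (hder2 t ht).differentiableWithinAt,
      hGc.congr fun t ht => derivWithin_Ico_eq ht (hder2 t ht)⟩
  have h0 : (0 : ℝ) ∈ Ico 0 S := left_mem_Ico.2 hS0
  refine ⟨S, hS0, fun t => (α t).1, ?_, hpos, fun t ht => ?_, by simp [hα0], ?_⟩
  · rw [show (2 : WithTop ℕ∞) = 1 + 1 by norm_num, contDiffOn_succ_iff_derivWithin hu]
    exact ⟨fun t ht => (hder1 t ht).differentiableWithinAt, by simp, hC1.congr he⟩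
  · rw [he ht]
    exact (hder2 t ht).congr he (he ht)
  · simp [he h0, hα0]

namespace IsCauchySolution

variable {η₀ η₁ T : ℝ} {η : ℝ → ℝ}

theorem hasDerivWithinAt_phase (h : IsCauchySolution G η₀ η₁ T η) {t : ℝ} (ht : t ∈ Ico 0 T) :
    HasDerivWithinAt (fun t => (η t, derivWithin η (Ico 0 T) t))
      (derivWithin η (Ico 0 T) t, G (η t, derivWithin η (Ico 0 T) t)) (Ico 0 T) t :=
  ((h.1.differentiableOn (by simp) t ht).hasDerivWithinAt).prodMk (h.2.2.1 t ht)

theorem continuousOn_phase (h : IsCauchySolution G η₀ η₁ T η) :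
    ContinuousOn (fun t => (η t, derivWithin η (Ico 0 T) t)) (Ico 0 T) :=
  fun _ ht => (h.hasDerivWithinAt_phase ht).continuousWithinAt

theorem hasDerivWithinAt_phase_Ici (h : IsCauchySolution G η₀ η₁ T η) {t : ℝ}
    (ht : t ∈ Ico 0 T) :
    HasDerivWithinAt (fun t => (η t, derivWithin η (Ico 0 T) t))
      (derivWithin η (Ico 0 T) t, G (η t, derivWithin η (Ico 0 T) t)) (Ici t) t :=
  (h.hasDerivWithinAt_phase ht).mono_of_mem_nhdsWithin
    (mem_of_superset (Ico_mem_nhdsGE ht.2) (Ico_subset_Ico_left ht.1))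

theorem eqOn (hG : LocallyLipschitzOn (Ioi (0 : ℝ) ×ˢ (univ : Set ℝ)) G)
    (h : IsCauchySolution G η₀ η₁ T η) {T' : ℝ} {ζ : ℝ → ℝ}
    (h' : IsCauchySolution G η₀ η₁ T' ζ) : EqOn η ζ (Ico 0 (min T T')) := by
  intro b hb
  have hsub : Icc 0 b ⊆ Ico 0 T :=
    fun t ht => ⟨ht.1, ht.2.trans_lt (hb.2.trans_le (min_le_left _ _))⟩
  have hsub' : Icc 0 b ⊆ Ico 0 T' :=
    fun t ht => ⟨ht.1, ht.2.trans_lt (hb.2.trans_le (min_le_right _ _))⟩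
  set f := fun t => (η t, derivWithin η (Ico 0 T) t)
  set g := fun t => (ζ t, derivWithin ζ (Ico 0 T') t)
  have hf : ContinuousOn f (Icc 0 b) := h.continuousOn_phase.mono hsub
  have hg : ContinuousOn g (Icc 0 b) := h'.continuousOn_phase.mono hsub'
  have hcpt : IsCompact (f '' Icc 0 b ∪ g '' Icc 0 b) :=
    (isCompact_Icc.image_of_continuousOn hf).union (isCompact_Icc.image_of_continuousOn hg)
  have hdom : f '' Icc 0 b ∪ g '' Icc 0 b ⊆ Ioi (0 : ℝ) ×ˢ (univ : Set ℝ) := by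
    rintro _ (⟨t, ht, rfl⟩ | ⟨t, ht, rfl⟩)
    · exact ⟨h.2.1 t (hsub ht), mem_univ _⟩
    · exact ⟨h'.2.1 t (hsub' ht), mem_univ _⟩
  -- Both phase curves over `[0, b]` lie in one compact set in the half plane, where the local
  -- Lipschitz property yields a single constant for Grönwall.
  obtain ⟨K, hK⟩ := LocallyLipschitzOn.exists_lipschitzOnWith_of_compact hcpt
    ((locallyLipschitzOn_firstOrderField hG).mono hdom)
  have hfg : f 0 = g 0 :=
    Prod.ext (h.2.2.2.1.trans h'.2.2.2.1.symm) (h.2.2.2.2.trans h'.2.2.2.2.symm)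
  have key := ODE_solution_unique_of_mem_Icc_right (v := fun _ z => (z.2, G z))
    (s := fun _ => f '' Icc 0 b ∪ g '' Icc 0 b) (fun _ _ => hK) hf
    (fun t ht => h.hasDerivWithinAt_phase_Ici (hsub (Ico_subset_Icc_self ht)))
    (fun t ht => .inl (mem_image_of_mem f (Ico_subset_Icc_self ht))) hg
    (fun t ht => h'.hasDerivWithinAt_phase_Ici (hsub' (Ico_subset_Icc_self ht)))
    (fun t ht => .inr (mem_image_of_mem g (Ico_subset_Icc_self ht))) hfg
  exact congrArg Prod.fst (key (right_mem_Icc.2 hb.1))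

end IsCauchySolution

end CauchyProblem
end

theorem theorem1 (Ω : Set Plane) (hΩo : IsOpen Ω) (hΩb : Bornology.IsBounded Ω)
    (hΩ0 : (0 : Plane) ∈ Ω) (h₀ : Plane → ℝ) (hC1 : IsC1OnClosure Ω h₀)
    (hmin : ∀ x ∈ Ω, 0 ≤ h₀ x) (hzero : h₀ 0 = 0) (F : ℝ) (hF : 0 < F) :
    (∀ β γ : ℝ, 0 < β → ∃! q : L2Pair Ω, IsReynoldsSolution Ω h₀ β γ q) ∧
    LocallyLipschitzOn (Ioi (0 : ℝ) ×ˢ (univ : Set ℝ)) (forceG Ω h₀ F) ∧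
    ∀ η₀ η₁ : ℝ, 0 < η₀ →
      (∃ T : ℝ, 0 < T ∧ ∃ η : ℝ → ℝ, IsCauchySolution (forceG Ω h₀ F) η₀ η₁ T η) ∧
      (∀ (T T' : ℝ) (η ζ : ℝ → ℝ), IsCauchySolution (forceG Ω h₀ F) η₀ η₁ T η →
        IsCauchySolution (forceG Ω h₀ F) η₀ η₁ T' ζ → EqOn η ζ (Ico 0 (min T T'))) := by
  have hm : AEStronglyMeasurable h₀ (volume.restrict Ω) :=
    (hC1.1.mono subset_closure).aestronglyMeasurable hΩo.measurableSet
  obtain ⟨M, hM⟩ := hΩb.isCompact_closure.exists_bound_of_continuousOn hC1.1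
  have hM' : ∀ᵐ x ∂(volume.restrict Ω), |h₀ x| ≤ M :=
    (ae_restrict_mem hΩo.measurableSet).mono fun x hx => hM x (subset_closure hx)
  have h0 : ∀ᵐ x ∂(volume.restrict Ω), 0 ≤ h₀ x :=
    (ae_restrict_mem hΩo.measurableSet).mono hmin
  have hG := locallyLipschitzOn_forceG hΩb hm hM' h0 F
  exact ⟨fun β γ hβ => existsUnique_isReynoldsSolution hΩb hm hM' h0 hβ γ, hG,
    fun η₀ η₁ hη₀ => ⟨exists_isCauchySolution hG hη₀ η₁, fun T T' η ζ h h' => h.eqOn hG h'⟩⟩
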